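/- For a group $G$ and $k\ge 0$ let $C_b^k(G;\mathbb{R})$ be the real vector space of all bounded functions $G^k\to\mathbb{R}$, and let $\delta_b^k\colon C_b^k(G;\mathbb{R})\to C_b^{k+1}(G;\mathbb{R})$ be the coboundary operator $$\delta_b^k(f)(x_0,\ldots,x_k)=f(x_1,\ldots,x_k)+\sum_{i=1}^{k}(-1)^i f(x_0,\ldots,x_{i-1}x_i,\ldots,x_k)+(-1)^{k+1}f(x_0,\ldots,x_{k-1}).$$ The second bounded cohomology of $G$ is the real vector space $H_b^2(G;\mathbb{R})=\ker\delta_b^2/\operatorname{im}\delta_b^1$. **Theorem.** Let $G$ be a finitely presented group and let $H$ be a subgroup of finite index in $G$. Suppose that there is a homomorphism from $H$ onto a free group $F_n$ of rank $n$ for some integer $n\ge 2$. Then the dimension of the real vector space $H_b^2(G;\mathbb{R})$ is equal to the cardinality of the continuum. -/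

import Mathlib

namespace BoundedCohomology

universe u

variable (G : Type u) [Group G]

/-- The coboundary operator on all inhomogeneous real-valued cochains (trivial action):
`(δ f)(x₀, …, xₙ) = f(x₁, …, xₙ) + ∑_{i=1}^{n} (-1)^i f(x₀, …, x_{i-1} x_i, …, xₙ)
  + (-1)^(n+1) f(x₀, …, x_{n-1})`.
Here `Fin.contractNth j (· * ·) x` multiplies the entries `j` and `j + 1` of `x` when `j < n`, and
for `j = n` it drops the last entry, so the term `j = n` of the sum is the last one above. -/
def coboundary (n : ℕ) : ((Fin n → G) → ℝ) →ₗ[ℝ] ((Fin (n + 1) → G) → ℝ) where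
  toFun f x := f (fun i => x i.succ) +
    ∑ j : Fin (n + 1), (-1 : ℝ) ^ ((j : ℕ) + 1) * f (Fin.contractNth j (· * ·) x)
  map_add' f g := by
    ext x
    simp [mul_add, Finset.sum_add_distrib, add_add_add_comm]
  map_smul' r f := by
    ext x
    simp [mul_add, Finset.mul_sum, mul_left_comm]

/-- The space `C_b^n(G; ℝ)` of bounded functions `Gⁿ → ℝ`. -/
def boundedCochains (n : ℕ) : Submodule ℝ ((Fin n → G) → ℝ) where
  carrier := {f | ∃ C : ℝ, ∀ x, |f x| ≤ C}
  add_mem' := by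
    rintro f g ⟨C, hC⟩ ⟨D, hD⟩
    exact ⟨C + D, fun x => (abs_add_le _ _).trans (add_le_add (hC x) (hD x))⟩
  zero_mem' := ⟨0, fun x => by simp⟩
  smul_mem' := by
    rintro r f ⟨C, hC⟩
    refine ⟨|r| * C, fun x => ?_⟩
    rw [Pi.smul_apply, smul_eq_mul, abs_mul]
    exact mul_le_mul_of_nonneg_left (hC x) (abs_nonneg r)

theorem coboundary_mem (n : ℕ) (f : (Fin n → G) → ℝ) (hf : f ∈ boundedCochains G n) :
    coboundary G n f ∈ boundedCochains G (n + 1) := by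
  obtain ⟨C, hC⟩ := hf
  refine ⟨C + ∑ _j : Fin (n + 1), C, fun x => ?_⟩
  refine (abs_add_le _ _).trans (add_le_add (hC _) ?_)
  refine (Finset.abs_sum_le_sum_abs _ _).trans (Finset.sum_le_sum fun j _ => ?_)
  rw [abs_mul, abs_pow, abs_neg, abs_one, one_pow, one_mul]
  exact hC _

theorem coboundary_coboundary (n : ℕ) (f : (Fin n → G) → ℝ) :
    coboundary G (n + 1) (coboundary G n f) = 0 := by
  let A : Rep.{u} (ULift.{u} ℝ) G := Rep.trivial (ULift.{u} ℝ) G (ULift.{u} ℝ)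
  have key : ∀ (m : ℕ) (g : (Fin m → G) → ℝ),
      (inhomogeneousCochains.d A m).hom (fun x => (ULift.up (g x) : ULift.{u} ℝ))
        = fun x => (ULift.up (coboundary G m g x) : ULift.{u} ℝ) := by
    intro m g
    funext x
    rw [inhomogeneousCochains.d_hom_apply]
    apply ULift.down_injective
    have hs : ∀ F : Fin (m + 1) → ULift.{u} ℝ, (∑ j, F j).down = ∑ j, (F j).down :=
      fun F => map_sum (ULift.ringEquiv : ULift.{u} ℝ ≃+* ℝ) F Finset.univ
    have hp : ∀ j : ℕ, ((-1 : ULift.{u} ℝ) ^ j).down = (-1 : ℝ) ^ j := fun j => by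
      simp
    simp [A, coboundary, hs, hp]
  have h := groupCohomology.inhomogeneousCochains.d_comp_d (A := A) (n := n)
  have h2 := congrArg (fun φ => φ.hom (fun x => (ULift.up (f x) : ULift.{u} ℝ))) h
  replace h2 : (inhomogeneousCochains.d A (n + 1)).hom
      ((inhomogeneousCochains.d A n).hom (fun x => (ULift.up (f x) : ULift.{u} ℝ))) = 0 := h2
  rw [key, key] at h2
  funext x
  exact congrArg ULift.down (congrFun h2 x)

/-- `Z_b^n(G; ℝ)`: the kernel of the coboundary operator `C_b^n(G; ℝ) → C_b^{n+1}(G; ℝ)`. -/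
def boundedCocycles (n : ℕ) : Submodule ℝ ((Fin n → G) → ℝ) :=
  boundedCochains G n ⊓ LinearMap.ker (coboundary G n)

/-- `B_b^n(G; ℝ)`: the image of the coboundary operator `C_b^{n-1}(G; ℝ) → C_b^n(G; ℝ)`
(zero in degree `0`). Only coboundaries of bounded cochains are taken. -/
def boundedCoboundaries : (n : ℕ) → Submodule ℝ ((Fin n → G) → ℝ)
  | 0 => ⊥
  | n + 1 => (boundedCochains G n).map (coboundary G n)

/-- The bounded cochains form a complex: bounded coboundaries are bounded cocycles. -/
theorem boundedCoboundaries_le (n : ℕ) : boundedCoboundaries G n ≤ boundedCocycles G n := by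
  cases n with
  | zero => exact bot_le
  | succ n =>
    rintro _ ⟨f, hf, rfl⟩
    exact ⟨coboundary_mem G n f hf, coboundary_coboundary G n f⟩

/-- The bounded cohomology `H_b^n(G; ℝ) = Z_b^n(G; ℝ) / B_b^n(G; ℝ)` of the discrete group `G`
with trivial real coefficients, as a real vector space. -/
abbrev H (n : ℕ) : Type u :=
  boundedCocycles G n ⧸ (boundedCoboundaries G n).submoduleOf (boundedCocycles G n)

end BoundedCohomology

/-! The coboundary of a quasimorphism of `G` is a bounded cocycle. It is trivial in bounded
cohomology only if the quasimorphism is at bounded distance from a homomorphism, and the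
homomorphisms from a finitely generated group to `ℝ` form a finite-dimensional space. So it suffices
to find quasimorphisms `Φ c`, linear in a bounded sequence `c`, whose growth rates along the powers
of suitable `x j` are `A j * c j` with `A j > 0`: the bounded sequences have dimension at least the
continuum (`continuum_le_rank_boundedSeq`). The upper bound is a cardinality count.

The free group maps onto `Γ = ℤ ∗ ℤ/2`. Summing a bounded odd function over consecutive pairs of
large exponents of the normal form gives a quasimorphism of `Γ` (`abs_countingFun_mul_sub_le`),
which is pulled back to `H` and transferred to `G`. On the normal core of `H` the rate of the
transfer is a sum over the cosets, and the danger is that the terms cancel.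

This is excluded by the test elements `u ^ N₀ * t * u ^ N₁ * t * u ^ N₂ * t` with rapidly growing
`Nᵢ`. In each coset the image of `u` is either conjugate to a nonzero power of `a`, or has powers
with bounded exponents (`exists_conj`). The threshold for large exponents is fixed after `u` and
`t`, so the second case gives rate zero. In the first case, the cyclic order of three different
scales prevents the reversed pattern from occurring (`oddPatternFun_cyclic_sum`). Hence every coset
contributes a nonnegative multiple of `c j` (`exists_threshold`), and the trivial coset contributes
exactly `c j`. -/

/-! ### Sums over consecutive entries of lists -/

/-- The sum of `f` over the pairs of consecutive entries of a list. -/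
def pairSum (f : ℤ → ℤ → ℝ) : List ℤ → ℝ
  | x :: y :: l => f x y + pairSum f (y :: l)
  | _ => 0

/-- The list read backwards with the signs of its entries changed. -/
def revNeg (l : List ℤ) : List ℤ := (l.map (fun x => -x)).reverse

theorem revNeg_cons (x : ℤ) (l : List ℤ) : revNeg (x :: l) = revNeg l ++ [-x] := by
  simp [revNeg]

theorem revNeg_append (l m : List ℤ) : revNeg (l ++ m) = revNeg m ++ revNeg l := by
  simp [revNeg]

theorem revNeg_revNeg (l : List ℤ) : revNeg (revNeg l) = l := by
  simp [revNeg]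

/-- The entries of absolute value greater than `B`. -/
def bigEntries (B : ℤ) (l : List ℤ) : List ℤ := l.filter (fun x => decide (B < |x|))

theorem bigEntries_append (B : ℤ) (l m : List ℤ) :
    bigEntries B (l ++ m) = bigEntries B l ++ bigEntries B m := by
  simp [bigEntries]

theorem bigEntries_revNeg (B : ℤ) (l : List ℤ) :
    bigEntries B (revNeg l) = revNeg (bigEntries B l) := by
  induction l with
  | nil => rfl
  | cons x l ih =>
    rw [revNeg_cons, bigEntries_append, ih]
    by_cases h : B < |x| <;> simp [bigEntries, h, revNeg]

theorem bigEntries_eq_nil {B : ℤ} {l : List ℤ} (h : ∀ x ∈ l, |x| ≤ B) : bigEntries B l = [] := by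
  simpa [bigEntries] using h

theorem bigEntries_singleton {B x : ℤ} (h : B < |x|) : bigEntries B [x] = [x] := by
  simp [bigEntries, h]

theorem length_bigEntries_singleton (B x : ℤ) : (bigEntries B [x]).length ≤ 1 := by
  by_cases h : B < |x| <;> simp [bigEntries, h]

theorem pairSum_of_length_le_one (f : ℤ → ℤ → ℝ) {l : List ℤ} (h : l.length ≤ 1) :
    pairSum f l = 0 := by
  match l, h with
  | [], _ => rfl
  | [_], _ => rfl

theorem pairSum_append_cons (f : ℤ → ℤ → ℝ) (l m : List ℤ) (x y : ℤ) :
    pairSum f (l ++ x :: y :: m) = pairSum f (l ++ [x]) + f x y + pairSum f (y :: m) := by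
  induction l with
  | nil => simp [pairSum]
  | cons z l ih =>
    cases l with
    | nil => simp [pairSum]; ring
    | cons w l =>
      simp only [List.cons_append, pairSum] at ih ⊢
      rw [ih]; ring

theorem abs_pairSum_append_sub_le {f : ℤ → ℤ → ℝ} {K : ℝ} (hf : ∀ x y, |f x y| ≤ K)
    (l m : List ℤ) : |pairSum f (l ++ m) - pairSum f l - pairSum f m| ≤ K := by
  have hK : 0 ≤ K := (abs_nonneg _).trans (hf 0 0)
  rcases List.eq_nil_or_concat l with rfl | ⟨l, x, rfl⟩
  · simpa [pairSum] using hK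
  · cases m with
    | nil => simpa [pairSum] using hK
    | cons y m =>
      have := pairSum_append_cons f l m x y
      simp only [List.concat_eq_append, List.append_assoc, List.singleton_append]
      rw [this]
      convert hf x y using 2
      ring

theorem pairSum_revNeg {f : ℤ → ℤ → ℝ} (hf : ∀ x y, f (-y) (-x) = - f x y) (l : List ℤ) :
    pairSum f (revNeg l) = - pairSum f l := by
  match l with
  | [] => simp [revNeg, pairSum]
  | [x] => simp [revNeg, pairSum]
  | x :: y :: l =>
    have ih := pairSum_revNeg hf (y :: l)
    rw [revNeg_cons] at ih
    rw [revNeg_cons, revNeg_cons, List.append_assoc, List.singleton_append, pairSum_append_cons, ih,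
      hf]
    simp [pairSum]

/-- The sum of `f` over the pairs of consecutive entries greater than `B` in absolute value. -/
def bigPairSum (f : ℤ → ℤ → ℝ) (B : ℤ) (l : List ℤ) : ℝ := pairSum f (bigEntries B l)

theorem bigPairSum_revNeg {f : ℤ → ℤ → ℝ} (hf : ∀ x y, f (-y) (-x) = - f x y) (B : ℤ)
    (l : List ℤ) : bigPairSum f B (revNeg l) = - bigPairSum f B l := by
  rw [bigPairSum, bigEntries_revNeg, pairSum_revNeg hf, bigPairSum]

theorem bigPairSum_eq_zero (f : ℤ → ℤ → ℝ) {B : ℤ} {l : List ℤ} (h : ∀ x ∈ l, |x| ≤ B) :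
    bigPairSum f B l = 0 := by
  simp [bigPairSum, bigEntries_eq_nil h, pairSum]

theorem bigPairSum_singleton (f : ℤ → ℤ → ℝ) (B x : ℤ) : bigPairSum f B [x] = 0 :=
  pairSum_of_length_le_one f (length_bigEntries_singleton B x)

theorem abs_bigPairSum_append_sub_le {f : ℤ → ℤ → ℝ} {K : ℝ} (hf : ∀ x y, |f x y| ≤ K) (B : ℤ)
    (l m : List ℤ) :
    |bigPairSum f B (l ++ m) - bigPairSum f B l - bigPairSum f B m| ≤ K := by
  rw [bigPairSum, bigEntries_append]
  exact abs_pairSum_append_sub_le hf _ _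

/-- Cut on both sides of `x`: each cut costs at most `K`, and a single entry contributes nothing,
whether it is big or not. -/
theorem abs_bigPairSum_append_cons_sub_le {f : ℤ → ℤ → ℝ} {K : ℝ} (hf : ∀ x y, |f x y| ≤ K) (B : ℤ)
    (l m : List ℤ) (x : ℤ) :
    |bigPairSum f B (l ++ x :: m) - bigPairSum f B l - bigPairSum f B m| ≤ 2 * K := by
  have h1 := abs_bigPairSum_append_sub_le hf B l ([x] ++ m)
  have h2 := abs_bigPairSum_append_sub_le hf B [x] m
  rw [bigPairSum_singleton] at h2
  rw [List.singleton_append] at h1 h2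
  rw [abs_le] at *
  constructor <;> linarith

/-- The concatenation of `k` copies of a list. -/
def listPow (l : List ℤ) : ℕ → List ℤ
  | 0 => []
  | k + 1 => l ++ listPow l k

theorem mem_of_mem_listPow {l : List ℤ} {x : ℤ} {k : ℕ} (h : x ∈ listPow l k) : x ∈ l := by
  induction k with
  | zero => simp [listPow] at h
  | succ k ih =>
    rcases List.mem_append.1 h with h | h
    exacts [h, ih h]

theorem bigEntries_listPow (B : ℤ) (l : List ℤ) (k : ℕ) :
    bigEntries B (listPow l k) = listPow (bigEntries B l) k := by
  induction k with
  | zero => rfl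
  | succ k ih => rw [listPow, bigEntries_append, ih, listPow]

theorem pairSum_listPow_triple (f : ℤ → ℤ → ℝ) (x y z : ℤ) (k : ℕ) :
    pairSum f (listPow [x, y, z] (k + 1)) = (k + 1) * (f x y + f y z + f z x) - f z x := by
  induction k with
  | zero => simp [listPow, pairSum]
  | succ k ih =>
    rw [listPow] at ih ⊢
    have : listPow [x, y, z] (k + 1) = x :: y :: z :: listPow [x, y, z] k := rfl
    simp only [this, List.cons_append, List.nil_append, pairSum] at ih ⊢
    rw [ih]
    push_cast
    ring

/-! ### Normal forms in `ℤ ∗ ℤ/2` -/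

/-- The interior entries of the list are nonzero, and the list is nonempty. -/
def IsReducedList (l : List ℤ) : Prop :=
  l ≠ [] ∧ ∀ p x q, l = p ++ x :: q → p ≠ [] → q ≠ [] → x ≠ 0

section Words

variable {Γ : Type*} [Group Γ] (a s : Γ)

/-- The product of the elements `s * a ^ e` over the entries `e` of a list. -/
def evalList : List ℤ → Γ
  | [] => 1
  | e :: l => s * a ^ e * evalList l

theorem evalList_append (l m : List ℤ) :
    evalList a s (l ++ m) = evalList a s l * evalList a s m := by
  induction l with
  | nil => simp [evalList]
  | cons x l ih => simp [evalList, ih, mul_assoc]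

theorem evalList_listPow (l : List ℤ) (k : ℕ) :
    evalList a s (listPow l k) = evalList a s l ^ k := by
  induction k with
  | zero => simp [listPow, evalList]
  | succ k ih => rw [listPow, evalList_append, ih, pow_succ']

/-- The element `a ^ e₀ * s * a ^ e₁ * ⋯ * s * a ^ eₖ` for a nonempty list `[e₀, …, eₖ]`
(when `s` is an involution). -/
def evalWord (l : List ℤ) : Γ := s * evalList a s l

/-- `Γ` is the free product of the infinite cyclic group generated by `a` and the group of order two
generated by `s`, in terms of normal forms. -/
structure IsFreeProductZZTwo : Prop where
  mul_self : s * s = 1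
  exists_evalWord : ∀ g, ∃ l, IsReducedList l ∧ evalWord a s l = g
  evalWord_inj : ∀ l m, IsReducedList l → IsReducedList m → evalWord a s l = evalWord a s m → l = m

end Words

theorem IsReducedList.singleton (x : ℤ) : IsReducedList [x] := by
  refine ⟨by simp, fun p y q h hp hq => ?_⟩
  have := congrArg List.length h
  have := List.length_pos_iff.2 hp
  have := List.length_pos_iff.2 hq
  simp at *
  omega

theorem IsReducedList.cons {l : List ℤ} (x : ℤ) (hl : ∀ y ∈ l, y ≠ 0) : IsReducedList (x :: l) := by
  refine ⟨by simp, fun p y q h hp _ => ?_⟩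
  obtain ⟨z, p, rfl⟩ := List.exists_cons_of_ne_nil hp
  rw [List.cons_append, List.cons.injEq] at h
  exact hl y (by simp [h.2])

theorem IsReducedList.of_cons {l : List ℤ} {x : ℤ} (h : IsReducedList (x :: l)) (hl : l ≠ []) :
    IsReducedList l :=
  ⟨hl, fun p y q e _ hq => h.2 (x :: p) y q (by simp [e]) (by simp) hq⟩

theorem IsReducedList.revNeg {l : List ℤ} (h : IsReducedList l) : IsReducedList (revNeg l) := by
  refine ⟨by simpa [_root_.revNeg] using h.1, fun p x q e hp hq => ?_⟩
  have h2 : l = _root_.revNeg q ++ (-x) :: _root_.revNeg p := by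
    rw [← revNeg_revNeg l, e, revNeg_append, revNeg_cons]
    simp
  have := h.2 _ _ _ h2 (by simpa [_root_.revNeg] using hq) (by simpa [_root_.revNeg] using hp)
  simpa using this

theorem IsReducedList.merge {p c q : List ℤ} {x y : ℤ} (h : IsReducedList (p ++ x :: c))
    (h' : IsReducedList (_root_.revNeg c ++ y :: q)) (hxy : p ≠ [] → q ≠ [] → x + y ≠ 0) :
    IsReducedList (p ++ (x + y) :: q) := by
  refine ⟨by simp, fun p' z q' e hp' hq' => ?_⟩
  rcases List.append_eq_append_iff.1 e with ⟨r, hr, hr'⟩ | ⟨r, hr, hr'⟩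
  · rcases r with _ | ⟨w, r⟩
    · simp only [List.nil_append, List.append_nil, List.cons.injEq] at hr hr'
      subst hr
      rw [← hr'.1]
      exact hxy hp' (by rw [hr'.2]; exact hq')
    · simp only [List.cons_append, List.cons.injEq] at hr'
      refine h'.2 (_root_.revNeg c ++ y :: r) z q' ?_ (by simp) hq'
      simp [hr'.2]
  · rcases r with _ | ⟨w, r⟩
    · simp only [List.nil_append, List.append_nil, List.cons.injEq] at hr hr'
      subst hr
      rw [hr'.1]
      exact hxy hp' (by rw [← hr'.2]; exact hq')
    · simp only [List.cons_append, List.cons.injEq] at hr'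
      refine h.2 p' z (r ++ x :: c) ?_ hp' (by simp)
      rw [hr, hr'.1]
      simp

/-- The product of two reduced words: `c` is cancelled, and `x` and `y` are then added. -/
theorem IsReducedList.exists_merge {l m : List ℤ} (hl : IsReducedList l) (hm : IsReducedList m) :
    ∃ p x c y q, l = p ++ x :: c ∧ m = _root_.revNeg c ++ y :: q ∧
      IsReducedList (p ++ (x + y) :: q) := by
  suffices H : ∀ (p c q : List ℤ) (x y : ℤ), l = p ++ x :: c → m = _root_.revNeg c ++ y :: q →
      ∃ p x c y q, l = p ++ x :: c ∧ m = _root_.revNeg c ++ y :: q ∧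
      IsReducedList (p ++ (x + y) :: q) by
    obtain ⟨y, q, rfl⟩ := List.exists_cons_of_ne_nil hm.1
    -- Cancellation starts at the junction of the two words, with nothing cancelled yet.
    exact H l.dropLast [] q (l.getLast hl.1) y (List.dropLast_append_getLast hl.1).symm
      (by simp [_root_.revNeg])
  intro p
  induction p using List.reverseRecOn with
  | nil =>
    intro c q x y h1 h2
    exact ⟨[], x, c, y, q, h1, h2,
      IsReducedList.merge (h1 ▸ hl) (h2 ▸ hm) (fun h => absurd rfl h)⟩
  | append_singleton p x' ih =>
    intro c q x y h1 h2
    by_cases hxy : q ≠ [] → x + y ≠ 0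
    · exact ⟨p ++ [x'], x, c, y, q, h1, h2, IsReducedList.merge (h1 ▸ hl) (h2 ▸ hm) fun _ => hxy⟩
    -- The exponents at the junction sum to zero with letters left on both sides, so the two
    -- adjacent involutions cancel and `x` joins the cancelled part.
    · push Not at hxy
      obtain ⟨y', q, rfl⟩ := List.exists_cons_of_ne_nil hxy.1
      refine ih (x :: c) q x' y' (by simp [h1]) ?_
      rw [h2, revNeg_cons, ← neg_eq_of_add_eq_zero_right hxy.2]
      simp

section Involution

variable {Γ : Type*} [Group Γ] {a s : Γ} (hs : s * s = 1)
include hs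

theorem evalList_revNeg (l : List ℤ) :
    evalList a s l * s * evalList a s (revNeg l) * s = 1 := by
  induction l with
  | nil => simp [evalList, revNeg, hs]
  | cons x l ih =>
    rw [revNeg_cons, evalList_append]
    calc _ = s * a ^ x * (evalList a s l * s * evalList a s (revNeg l) * s) * a ^ (-x) * s := by
          simp [evalList, mul_assoc]
      _ = 1 := by
          rw [ih]
          simp [mul_assoc, hs]

theorem evalWord_inv (l : List ℤ) : (evalWord a s l)⁻¹ = evalWord a s (revNeg l) := by
  refine inv_eq_of_mul_eq_one_right ?_
  have h := evalList_revNeg (a := a) hs l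
  rw [evalWord, evalWord]
  calc _ = s * (evalList a s l * s * evalList a s (revNeg l) * s) * s⁻¹ := by group
    _ = 1 := by rw [h]; group

theorem evalWord_mul (p c q : List ℤ) (x y : ℤ) :
    evalWord a s (p ++ x :: c) * evalWord a s (revNeg c ++ y :: q)
      = evalWord a s (p ++ (x + y) :: q) := by
  have h := evalList_revNeg (a := a) hs c
  simp only [evalWord, evalList_append, evalList, zpow_add]
  calc _ = s * evalList a s p * s * a ^ x * (evalList a s c * s * evalList a s (revNeg c) * s)
        * a ^ y * evalList a s q := by group
    _ = _ := by rw [h]; group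

end Involution

/-! ### Counting quasimorphisms -/

namespace IsFreeProductZZTwo

variable {Γ : Type*} [Group Γ] {a s : Γ} (hΓ : IsFreeProductZZTwo a s)
include hΓ

theorem inv_eq : s⁻¹ = s := inv_eq_of_mul_eq_one_left hΓ.mul_self

theorem evalWord_singleton (x : ℤ) : evalWord a s [x] = a ^ x := by
  simp [evalWord, evalList, ← mul_assoc, hΓ.mul_self]

theorem evalWord_zero_cons (l : List ℤ) : evalWord a s (0 :: l) = evalList a s l := by
  simp [evalWord, evalList, ← mul_assoc, hΓ.mul_self]

theorem evalWord_cons (x : ℤ) (l : List ℤ) : evalWord a s (x :: l) = a ^ x * evalList a s l := by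
  simp [evalWord, evalList, ← mul_assoc, hΓ.mul_self]

/-- The normal form of an element. -/
noncomputable def normalForm (g : Γ) : List ℤ := (hΓ.exists_evalWord g).choose

theorem isReducedList_normalForm (g : Γ) : IsReducedList (hΓ.normalForm g) :=
  (hΓ.exists_evalWord g).choose_spec.1

theorem evalWord_normalForm (g : Γ) : evalWord a s (hΓ.normalForm g) = g :=
  (hΓ.exists_evalWord g).choose_spec.2

theorem normalForm_evalWord {l : List ℤ} (hl : IsReducedList l) :
    hΓ.normalForm (evalWord a s l) = l :=
  hΓ.evalWord_inj _ _ (hΓ.isReducedList_normalForm _) hl (hΓ.evalWord_normalForm _)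

theorem normalForm_one : hΓ.normalForm 1 = [0] := by
  have := hΓ.normalForm_evalWord (IsReducedList.singleton 0)
  rwa [hΓ.evalWord_singleton, zpow_zero] at this

theorem exists_normalForm_mul (g h : Γ) : ∃ p x c y q, hΓ.normalForm g = p ++ x :: c ∧
    hΓ.normalForm h = revNeg c ++ y :: q ∧ hΓ.normalForm (g * h) = p ++ (x + y) :: q := by
  obtain ⟨p, x, c, y, q, h1, h2, h3⟩ :=
    (hΓ.isReducedList_normalForm g).exists_merge (hΓ.isReducedList_normalForm h)
  refine ⟨p, x, c, y, q, h1, h2, ?_⟩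
  rw [← hΓ.normalForm_evalWord h3, ← evalWord_mul hΓ.mul_self p c, ← h1, ← h2, hΓ.evalWord_normalForm,
    hΓ.evalWord_normalForm]

/-- The quasimorphism given by a sum over the pairs of consecutive big exponents of the normal
form. -/
noncomputable def countingFun (f : ℤ → ℤ → ℝ) (B : ℤ) (g : Γ) : ℝ :=
  bigPairSum f B (hΓ.normalForm g)

/-- Each of the three normal forms is split at the junction, with error `2 * K`. The cancelled part
`c` occurs once as `c` and once as `revNeg c`, and by oddness of `f` these two contributions cancel.
-/
theorem abs_countingFun_mul_sub_le {f : ℤ → ℤ → ℝ} {K : ℝ} (hK : ∀ x y, |f x y| ≤ K)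
    (hf : ∀ x y, f (-y) (-x) = - f x y) (B : ℤ) (g h : Γ) :
    |hΓ.countingFun f B (g * h) - hΓ.countingFun f B g - hΓ.countingFun f B h| ≤ 6 * K := by
  obtain ⟨p, x, c, y, q, h1, h2, h3⟩ := hΓ.exists_normalForm_mul g h
  have e1 := abs_bigPairSum_append_cons_sub_le hK B p c x
  have e2 := abs_bigPairSum_append_cons_sub_le hK B (revNeg c) q y
  have e3 := abs_bigPairSum_append_cons_sub_le hK B p q (x + y)
  rw [bigPairSum_revNeg hf] at e2
  rw [countingFun, countingFun, countingFun, h1, h2, h3]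
  rw [abs_le] at *
  constructor <;> linarith

/-- All exponents of the normal form of `g` are at most `M` in absolute value. -/
def ExponentsLE (M : ℤ) (g : Γ) : Prop := ∀ x ∈ hΓ.normalForm g, |x| ≤ M

theorem exponentsLE_mul {M M' : ℤ} {g h : Γ} (hg : hΓ.ExponentsLE M g) (hh : hΓ.ExponentsLE M' h) :
    hΓ.ExponentsLE (M + M') (g * h) := by
  obtain ⟨p, x, c, y, q, h1, h2, h3⟩ := hΓ.exists_normalForm_mul g h
  simp only [ExponentsLE, h1, h2, h3, List.mem_append, List.mem_cons] at hg hh ⊢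
  have hx := hg x (by simp)
  have hy := hh y (by simp)
  have := abs_nonneg x
  have := abs_nonneg y
  rintro z (hz | rfl | hz)
  · linarith [hg z (by simp [hz])]
  · linarith [abs_add_le x y]
  · linarith [hh z (by simp [hz])]

theorem exists_exponentsLE (g : Γ) : ∃ M : ℤ, 0 ≤ M ∧ hΓ.ExponentsLE M g := by
  refine ⟨((hΓ.normalForm g).map (fun x => |x|)).sum, ?_, fun x hx => ?_⟩
  · exact List.sum_nonneg (by simp)
  · exact List.single_le_sum (by simp) _ (List.mem_map_of_mem hx)

end IsFreeProductZZTwo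

/-! ### Quasimorphisms and growth rates -/

section Rates

variable {Γ : Type*} [Group Γ]

/-- `φ` is a homomorphism up to a bounded error. -/
def IsQuasimorphism (φ : Γ → ℝ) : Prop := ∃ D, ∀ g h, |φ (g * h) - φ g - φ h| ≤ D

/-- `φ (g ^ k)` is `k * r` up to a bounded error, so `r` is the value at `g` of the homogenization of
a quasimorphism `φ`. -/
def HasRate (φ : Γ → ℝ) (g : Γ) (r : ℝ) : Prop := ∃ C, ∀ k : ℕ, |φ (g ^ k) - k * r| ≤ C

theorem HasRate.unique {φ : Γ → ℝ} {g : Γ} {r r' : ℝ} (h : HasRate φ g r) (h' : HasRate φ g r') :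
    r = r' := by
  obtain ⟨C, hC⟩ := h
  obtain ⟨C', hC'⟩ := h'
  by_contra hne
  obtain ⟨k, hk⟩ := exists_nat_gt ((C + C') / |r - r'|)
  have hpos : 0 < |r - r'| := abs_pos.2 (sub_ne_zero.2 hne)
  rw [div_lt_iff₀ hpos] at hk
  have h1 : (k : ℝ) * |r - r'| = |(φ (g ^ k) - k * r') - (φ (g ^ k) - k * r)| := by
    rw [show φ (g ^ k) - k * r' - (φ (g ^ k) - k * r) = k * (r - r') by ring, abs_mul, Nat.abs_cast]
  have h2 := abs_sub (φ (g ^ k) - k * r') (φ (g ^ k) - k * r)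
  linarith [hC k, hC' k]

theorem HasRate.add {φ ψ : Γ → ℝ} {g : Γ} {r r' : ℝ} (h : HasRate φ g r) (h' : HasRate ψ g r') :
    HasRate (φ + ψ) g (r + r') := by
  obtain ⟨C, hC⟩ := h
  obtain ⟨C', hC'⟩ := h'
  refine ⟨C + C', fun k => ?_⟩
  have := abs_add_le (φ (g ^ k) - k * r) (ψ (g ^ k) - k * r')
  rw [Pi.add_apply, show φ (g ^ k) + ψ (g ^ k) - k * (r + r')
    = (φ (g ^ k) - k * r) + (ψ (g ^ k) - k * r') by ring]
  linarith [hC k, hC' k]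

theorem HasRate.smul {φ : Γ → ℝ} {g : Γ} {r : ℝ} (c : ℝ) (h : HasRate φ g r) :
    HasRate (c • φ) g (c * r) := by
  obtain ⟨C, hC⟩ := h
  refine ⟨|c| * C, fun k => ?_⟩
  rw [Pi.smul_apply, smul_eq_mul, show c * φ (g ^ k) - k * (c * r) = c * (φ (g ^ k) - k * r) by ring,
    abs_mul]
  exact mul_le_mul_of_nonneg_left (hC k) (abs_nonneg c)

theorem HasRate.sum {ι : Type*} (t : Finset ι) {φ : ι → Γ → ℝ} {g : Γ} {r : ι → ℝ}
    (h : ∀ i ∈ t, HasRate (φ i) g (r i)) :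
    HasRate (fun x => ∑ i ∈ t, φ i x) g (∑ i ∈ t, r i) := by
  classical
  induction t using Finset.induction_on with
  | empty => exact ⟨0, by simp⟩
  | insert i t hi ih =>
    have := (h i (by simp)).add (ih fun j hj => h j (by simp [hj]))
    simp only [Finset.sum_insert hi]
    exact this

theorem IsQuasimorphism.hasRate_conj {φ : Γ → ℝ} (hφ : IsQuasimorphism φ) {g : Γ} {r : ℝ}
    (h : HasRate φ g r) (x : Γ) : HasRate φ (x * g * x⁻¹) r := by
  obtain ⟨D, hD⟩ := hφ
  obtain ⟨C, hC⟩ := h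
  refine ⟨C + 2 * D + |φ x| + |φ x⁻¹|, fun k => ?_⟩
  rw [conj_pow]
  have h1 := hD (x * g ^ k) x⁻¹
  have h2 := hD x (g ^ k)
  have h3 := hC k
  have h4 := le_abs_self (φ x)
  have h5 := neg_abs_le (φ x)
  have h6 := le_abs_self (φ x⁻¹)
  have h7 := neg_abs_le (φ x⁻¹)
  rw [abs_le] at h1 h2 h3 ⊢
  constructor <;> linarith

end Rates

/-! ### Cyclic reduction and rates in the free product -/

namespace IsFreeProductZZTwo

variable {Γ : Type*} [Group Γ] {a s : Γ} (hΓ : IsFreeProductZZTwo a s)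
include hΓ

theorem isQuasimorphism_countingFun {f : ℤ → ℤ → ℝ} {K : ℝ} (hK : ∀ x y, |f x y| ≤ K)
    (hf : ∀ x y, f (-y) (-x) = - f x y) (B : ℤ) : IsQuasimorphism (hΓ.countingFun f B) :=
  ⟨6 * K, hΓ.abs_countingFun_mul_sub_le hK hf B⟩

theorem exponentsLE_evalWord {M : ℤ} {l : List ℤ} (hl : IsReducedList l) (h : ∀ x ∈ l, |x| ≤ M) :
    hΓ.ExponentsLE M (evalWord a s l) := by
  rwa [ExponentsLE, hΓ.normalForm_evalWord hl]

theorem exponentsLE_one {M : ℤ} (hM : 0 ≤ M) : hΓ.ExponentsLE M 1 := by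
  simpa [ExponentsLE, hΓ.normalForm_one] using hM

theorem exponentsLE_evalList {M : ℤ} (hM : 0 ≤ M) {l : List ℤ} (h : ∀ x ∈ l, x ≠ 0 ∧ |x| ≤ M) :
    hΓ.ExponentsLE M (evalList a s l) := by
  rw [← hΓ.evalWord_zero_cons]
  refine hΓ.exponentsLE_evalWord (IsReducedList.cons 0 fun x hx => (h x hx).1) fun x hx => ?_
  rcases List.mem_cons.1 hx with rfl | hx
  · simpa using hM
  · exact (h x hx).2

theorem exponentsLE_involution_pow {M : ℤ} (hM : 0 ≤ M) (k : ℕ) : hΓ.ExponentsLE M (s ^ k) := by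
  have h2 : s ^ 2 = 1 := by rw [pow_two, hΓ.mul_self]
  rcases Nat.even_or_odd' k with ⟨j, rfl | rfl⟩
  · rw [pow_mul, h2, one_pow]
    exact hΓ.exponentsLE_one hM
  · rw [pow_succ, pow_mul, h2, one_pow, one_mul]
    have hs : evalWord a s [0, 0] = s := by simp [evalWord, evalList, hΓ.mul_self]
    suffices H : hΓ.ExponentsLE M (evalWord a s [0, 0]) by rwa [hs] at H
    refine hΓ.exponentsLE_evalWord ⟨by simp, fun p x q h hp hq => ?_⟩ (by simpa using hM)
    have := congrArg List.length h
    have := List.length_pos_iff.2 hp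
    have := List.length_pos_iff.2 hq
    simp at *
    omega

/-- Cyclic reduction: up to conjugation, an element is a power of `a` or its powers have bounded
exponents. -/
theorem exists_conj {M : ℤ} (hM : 0 ≤ M) {g : Γ} (hg : hΓ.ExponentsLE M g) :
    ∃ h y, g = h * y * h⁻¹ ∧
      ((∃ e : ℤ, y = a ^ e) ∨ ∀ k : ℕ, hΓ.ExponentsLE (2 * M) (y ^ k)) := by
  suffices H : ∀ (k : ℕ) (l : List ℤ), l.length = k → IsReducedList l → (∀ x ∈ l, |x| ≤ M) →
      ∃ h y, evalWord a s l = h * y * h⁻¹ ∧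
      ((∃ e : ℤ, y = a ^ e) ∨ ∀ k : ℕ, hΓ.ExponentsLE (2 * M) (y ^ k)) by
    have := H _ _ rfl (hΓ.isReducedList_normalForm g) hg
    rwa [hΓ.evalWord_normalForm] at this
  intro k
  induction k using Nat.strong_induction_on with
  | _ k ih =>
    intro l hk hl hlM
    obtain ⟨e, l, rfl⟩ := List.exists_cons_of_ne_nil hl.1
    rcases List.eq_nil_or_concat l with rfl | ⟨l, z, rfl⟩
    · exact ⟨1, a ^ e, by simp [hΓ.evalWord_singleton], Or.inl ⟨e, rfl⟩⟩
    rw [List.concat_eq_append] at *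
    have hl0 : ∀ x ∈ l, x ≠ 0 := by
      intro x hx
      obtain ⟨p, q, rfl⟩ := List.append_of_mem hx
      exact hl.2 (e :: p) x (q ++ [z]) (by simp) (by simp) (by simp)
    -- Conjugation by `a ^ e` moves the first exponent to the end, where it is added to `z`. If `z +
    -- e = 0`, the result is `s` or a shorter word conjugated by `s`. Otherwise powers are plain
    -- concatenations, and the bound `2 * M` comes from `z + e`.
    have hconj : evalWord a s (e :: (l ++ [z])) = a ^ e * evalList a s (l ++ [z + e]) * (a ^ e)⁻¹ := by
      rw [hΓ.evalWord_cons, evalList_append, evalList_append]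
      simp only [evalList, zpow_add]
      group
    have hM2 : M ≤ 2 * M := by linarith
    by_cases hze : z + e = 0
    · cases l with
      | nil =>
        refine ⟨a ^ e, s, ?_, Or.inr fun k => hΓ.exponentsLE_involution_pow (by linarith) k⟩
        rw [hconj, hze]
        simp [evalList]
      | cons x l =>
        have hred : IsReducedList (x :: l) := IsReducedList.cons x fun y hy => hl0 y (by simp [hy])
        obtain ⟨h, y, hy, hy'⟩ := ih _ (by rw [← hk]; simp) (x :: l) rfl hred
          fun y hy => hlM y (by
            rcases List.mem_cons.1 hy with rfl | hy
            · simp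
            · simp [hy])
        refine ⟨a ^ e * s * h, y, ?_, hy'⟩
        have h1 : evalList a s (x :: l ++ [z + e]) = s * evalWord a s (x :: l) * s := by
          rw [evalList_append, hze, hΓ.evalWord_cons]
          simp [evalList, mul_assoc]
        rw [hconj, h1, hy]
        nth_rewrite 2 [← hΓ.inv_eq]
        group
    · refine ⟨a ^ e, _, hconj, Or.inr fun k => ?_⟩
      rw [← evalList_listPow]
      refine hΓ.exponentsLE_evalList (by linarith) fun x hx => ?_
      have hx := mem_of_mem_listPow hx
      rcases List.mem_append.1 hx with hx | hx
      · exact ⟨hl0 x hx, (hlM x (by simp [hx])).trans hM2⟩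
      · rw [List.mem_singleton.1 hx]
        refine ⟨hze, (abs_add_le _ _).trans ?_⟩
        linarith [hlM z (by simp), hlM e (by simp)]

theorem hasRate_zpow (f : ℤ → ℤ → ℝ) (B e : ℤ) : HasRate (hΓ.countingFun f B) (a ^ e) 0 := by
  refine ⟨0, fun k => ?_⟩
  rw [← zpow_natCast, ← zpow_mul, ← hΓ.evalWord_singleton, countingFun,
    hΓ.normalForm_evalWord (IsReducedList.singleton _), bigPairSum_singleton]
  simp

theorem hasRate_zero_of_exponentsLE {f : ℤ → ℤ → ℝ} {B M : ℤ}
    (hφ : IsQuasimorphism (hΓ.countingFun f B)) (hM : 0 ≤ M) (hMB : 2 * M ≤ B) {g : Γ}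
    (hg : hΓ.ExponentsLE M g) : HasRate (hΓ.countingFun f B) g 0 := by
  obtain ⟨h, y, rfl, ⟨e, rfl⟩ | hy⟩ := hΓ.exists_conj hM hg
  · exact hφ.hasRate_conj (hΓ.hasRate_zpow f B e) h
  · refine hφ.hasRate_conj ⟨0, fun k => ?_⟩ h
    rw [countingFun, bigPairSum_eq_zero f fun x hx => (hy k x hx).trans hMB]
    simp

theorem hasRate_evalList_triple {f : ℤ → ℤ → ℝ} {B : ℤ} (hB : 0 ≤ B) {l : List ℤ}
    (hl : ∀ x ∈ l, x ≠ 0 ∧ |x| ≤ B) {X Y Z : ℤ} (hX : B < |X|) (hY : B < |Y|) (hZ : B < |Z|) :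
    HasRate (hΓ.countingFun f B) (evalList a s (l ++ X :: (l ++ Y :: (l ++ [Z]))))
      (f X Y + f Y Z + f Z X) := by
  have hne : ∀ {X : ℤ}, B < |X| → X ≠ 0 := fun h h0 => by simp [h0] at h; omega
  have hbig : bigEntries B (l ++ X :: (l ++ Y :: (l ++ [Z]))) = [X, Y, Z] := by
    rw [bigEntries_append, bigEntries_eq_nil fun x hx => (hl x hx).2, ← List.singleton_append,
      bigEntries_append, bigEntries_append, bigEntries_eq_nil fun x hx => (hl x hx).2,
      ← List.singleton_append (l := l ++ [Z]), bigEntries_append, bigEntries_append,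
      bigEntries_eq_nil fun x hx => (hl x hx).2, bigEntries_singleton hX, bigEntries_singleton hY,
      bigEntries_singleton hZ]
    rfl
  refine ⟨|f Z X|, fun k => ?_⟩
  -- The leading exponent `0` makes the repeated word a normal form. It is not big, so only the
  -- cyclic repetition of `X, Y, Z` counts, short of one closing pair `(Z, X)`.
  rw [← evalList_listPow, ← hΓ.evalWord_zero_cons, countingFun, hΓ.normalForm_evalWord]
  · rw [bigPairSum, ← List.singleton_append, bigEntries_append, bigEntries_listPow, hbig,
      bigEntries_eq_nil (by simpa using hB), List.nil_append]
    cases k with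
    | zero => simp [listPow, pairSum]
    | succ k =>
      rw [pairSum_listPow_triple]
      push_cast
      rw [show ∀ u v : ℝ, u - v - u = -v by intros; ring, abs_neg]
  · refine IsReducedList.cons 0 fun x hx => ?_
    have hx := mem_of_mem_listPow hx
    simp only [List.mem_append, List.mem_cons, List.not_mem_nil, or_false] at hx
    rcases hx with hx | rfl | hx | rfl | hx | rfl
    exacts [(hl x hx).1, hne hX, (hl x hx).1, hne hY, (hl x hx).1, hne hZ]

end IsFreeProductZZTwo

/-! ### Scales and patterns -/

/-- A rapidly increasing sequence of exponents. -/
def scale (B m : ℕ) : ℕ := (2 * B + 2) ^ (m + 1)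

theorem scale_pos (B m : ℕ) : 0 < scale B m := by
  unfold scale; positivity

theorem mul_scale_le {B m m' : ℕ} (h : m < m') : (2 * B + 2) * scale B m ≤ scale B m' := by
  rw [scale, scale, ← pow_succ']
  exact Nat.pow_le_pow_right (by omega) (by omega)

theorem le_scale (B m : ℕ) : 2 * B + 2 ≤ scale B m :=
  Nat.le_self_pow (by omega) _

/-- The left side lies between `scale B m - B` and `B * scale B m + B`, and the right side between
`scale B m' + 1` and `B * scale B m' + 1`. Successive scales differ by a factor of `2 * B + 2`, so
these ranges are disjoint for `m ≠ m'`. -/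
theorem eq_of_abs_add_mul_scale {B : ℕ} {e x : ℤ} {p m m' : ℕ} (he : e ≠ 0) (heB : |e| ≤ B)
    (hxB : |x| ≤ B) (hp : 0 < p) (hpB : p ≤ B) (h : |x + e * scale B m| = p * scale B m' + 1) :
    m = m' := by
  have hn := scale_pos B m
  have hn' := scale_pos B m'
  have he1 : 1 ≤ |e| := Int.one_le_abs he
  have hen : |e * (scale B m : ℤ)| = |e| * scale B m := by
    rw [abs_mul, Nat.abs_cast]
  have h1 := abs_add_le x (e * scale B m)
  have h2 := abs_sub_abs_le_abs_add (e * (scale B m : ℤ)) x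
  rw [add_comm _ x] at h2
  rw [h, hen] at h1 h2
  zify at hn hn' hp hpB
  rcases lt_trichotomy m m' with hlt | heq | hlt
  · have h3 := mul_scale_le (B := B) hlt
    zify at h3
    nlinarith
  · exact heq
  · have h3 := mul_scale_le (B := B) hlt
    zify at h3
    nlinarith

theorem lt_abs_add_mul_scale {B : ℕ} {e x : ℤ} {m : ℕ} (he : e ≠ 0) (hxB : |x| ≤ B) :
    (B : ℤ) < |x + e * scale B m| := by
  have he1 : 1 ≤ |e| := Int.one_le_abs he
  have hen : |e * (scale B m : ℤ)| = |e| * scale B m := by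
    rw [abs_mul, Nat.abs_cast]
  have h2 := abs_sub_abs_le_abs_add (e * (scale B m : ℤ)) x
  rw [add_comm _ x, hen] at h2
  have h3 := le_scale B m
  zify at h3
  nlinarith

open Classical in
/-- The function on pairs of exponents with the value `c j` at a pair of exponents attached to `j`,
and zero at all other pairs. -/
noncomputable def patternFun (B p : ℕ) (c : ℕ → ℝ) (x y : ℤ) : ℝ :=
  if h : ∃ j : ℕ, x = p * scale B (3 * j) + 1 ∧ y = p * scale B (3 * j + 1) + 1 then c h.choose else 0

/-- The antisymmetrization of `patternFun`. -/
noncomputable def oddPatternFun (B p : ℕ) (c : ℕ → ℝ) (x y : ℤ) : ℝ :=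
  patternFun B p c x y - patternFun B p c (-y) (-x)

theorem oddPatternFun_neg (B p : ℕ) (c : ℕ → ℝ) (x y : ℤ) :
    oddPatternFun B p c (-y) (-x) = - oddPatternFun B p c x y := by
  simp [oddPatternFun]

theorem abs_oddPatternFun_le {B p : ℕ} {c : ℕ → ℝ} {C : ℝ} (hc : ∀ j, |c j| ≤ C) (x y : ℤ) :
    |oddPatternFun B p c x y| ≤ 2 * C := by
  have h : ∀ x y, |patternFun B p c x y| ≤ C := by
    intro x y
    unfold patternFun
    split_ifs
    · exact hc _
    · simpa using (abs_nonneg _).trans (hc 0)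
  have := abs_sub (patternFun B p c x y) (patternFun B p c (-y) (-x))
  unfold oddPatternFun
  linarith [h x y, h (-y) (-x)]

/-- The index chosen in `patternFun` depends on the pair of exponents but not on the coefficients.
-/
theorem oddPatternFun_add (B p : ℕ) (c d : ℕ → ℝ) (x y : ℤ) :
    oddPatternFun B p (c + d) x y = oddPatternFun B p c x y + oddPatternFun B p d x y := by
  have h : ∀ x y, patternFun B p (c + d) x y = patternFun B p c x y + patternFun B p d x y := by
    intro x y
    unfold patternFun
    split_ifs <;> simp
  simp only [oddPatternFun, h]
  ring

theorem oddPatternFun_smul (B p : ℕ) (r : ℝ) (c : ℕ → ℝ) (x y : ℤ) :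
    oddPatternFun B p (r • c) x y = r * oddPatternFun B p c x y := by
  have h : ∀ x y, patternFun B p (r • c) x y = r * patternFun B p c x y := by
    intro x y
    unfold patternFun
    split_ifs <;> simp
  simp only [oddPatternFun, h]
  ring

theorem patternFun_eq_zero {B p : ℕ} {c : ℕ → ℝ} {x y : ℤ}
    (h : ∀ j : ℕ, x = p * scale B (3 * j) + 1 → y = p * scale B (3 * j + 1) + 1 → False) :
    patternFun B p c x y = 0 :=
  dif_neg fun ⟨j, h1, h2⟩ => h j h1 h2

theorem patternFun_apply {B p : ℕ} (hp : 0 < p) (hpB : p ≤ B) (c : ℕ → ℝ) (j : ℕ) :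
    patternFun B p c (p * scale B (3 * j) + 1) (p * scale B (3 * j + 1) + 1) = c j := by
  have h : ∃ i : ℕ, (p * scale B (3 * j) + 1 : ℤ) = p * scale B (3 * i) + 1 ∧
      (p * scale B (3 * j + 1) + 1 : ℤ) = p * scale B (3 * i + 1) + 1 := ⟨j, rfl, rfl⟩
  rw [patternFun, dif_pos h]
  congr 1
  have h1 := h.choose_spec.1
  have h2 := eq_of_abs_add_mul_scale (B := B) (e := p) (x := 1) (p := p) (m := 3 * j)
    (m' := 3 * h.choose) (by omega) (by simpa using hpB) (by simp; omega) hp hpB (by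
      rw [← h1, abs_of_nonneg (by positivity)]
      ring)
  omega

theorem exists_patternFun_eq {B p : ℕ} {e x : ℤ} (he : e ≠ 0) (heB : |e| ≤ B) (hxB : |x| ≤ B)
    (hp : 0 < p) (hpB : p ≤ B) (j : ℕ) (y : ℤ) :
    ∃ A : ℝ, 0 ≤ A ∧ ∀ c, patternFun B p c (x + e * scale B (3 * j)) y = A * c j := by
  by_cases h : ∃ i : ℕ, x + e * scale B (3 * j) = p * scale B (3 * i) + 1 ∧
      y = p * scale B (3 * i + 1) + 1
  · refine ⟨1, zero_le_one, fun c => ?_⟩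
    obtain ⟨i, h1, h2⟩ := h
    have := eq_of_abs_add_mul_scale he heB hxB hp hpB
      (by rw [h1, abs_of_nonneg (by positivity)])
    obtain rfl : j = i := by omega
    rw [h1, h2, patternFun_apply hp hpB, one_mul]
  · exact ⟨0, le_rfl, fun c => by rw [patternFun, dif_neg h, zero_mul]⟩

/-- A pattern has scale indices `3 * i, 3 * i + 1` in this order. Read forwards, the cyclic triple
`3 * j, 3 * j + 1, 3 * j + 2` allows it only at its first pair. Read backwards, the pairs are `(3 *
j + 1, 3 * j)`, `(3 * j + 2, 3 * j + 1)` and `(3 * j, 3 * j + 2)`, and none fits. Two scales would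
not suffice, since a cyclic pair reads the same in both directions. -/
theorem oddPatternFun_cyclic_sum {B p : ℕ} {e x : ℤ} (he : e ≠ 0) (heB : |e| ≤ B) (hxB : |x| ≤ B)
    (hp : 0 < p) (hpB : p ≤ B) (c : ℕ → ℝ) (j : ℕ) :
    oddPatternFun B p c (x + e * scale B (3 * j + 1)) (x + e * scale B (3 * j + 2))
      + oddPatternFun B p c (x + e * scale B (3 * j + 2)) (x + e * scale B (3 * j))
      + oddPatternFun B p c (x + e * scale B (3 * j)) (x + e * scale B (3 * j + 1))
      = patternFun B p c (x + e * scale B (3 * j)) (x + e * scale B (3 * j + 1)) := by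
  have key : ∀ {m m' : ℕ}, x + e * scale B m = p * scale B m' + 1 → m = m' := fun h =>
    eq_of_abs_add_mul_scale he heB hxB hp hpB (by rw [h, abs_of_nonneg (by positivity)])
  have key' : ∀ {m m' : ℕ}, -(x + e * scale B m) = p * scale B m' + 1 → m = m' := fun h =>
    eq_of_abs_add_mul_scale he heB hxB hp hpB (by rw [← abs_neg, h, abs_of_nonneg (by positivity)])
  unfold oddPatternFun
  rw [patternFun_eq_zero (x := x + e * scale B (3 * j + 1)),
    patternFun_eq_zero (x := x + e * scale B (3 * j + 2)),
    patternFun_eq_zero (x := -(x + e * scale B (3 * j + 2))),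
    patternFun_eq_zero (x := -(x + e * scale B (3 * j))),
    patternFun_eq_zero (x := -(x + e * scale B (3 * j + 1)))]
  · ring
  · intro i h _
    have := key' h
    omega
  · intro i h h'
    have := key' h
    have := key' h'
    omega
  · intro i h _
    have := key' h
    omega
  · intro i h _
    have := key h
    omega
  · intro i h _
    have := key h
    omega

/-! ### Rates at the test elements -/

section TestElement

variable {Γ : Type*} [Group Γ]

/-- The elements at which the quasimorphisms are evaluated. -/
def testElement (B j : ℕ) (u t : Γ) : Γ :=
  u ^ scale B (3 * j) * t * u ^ scale B (3 * j + 1) * t * u ^ scale B (3 * j + 2) * t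

theorem map_testElement {Γ' : Type*} [Group Γ'] (f : Γ →* Γ') (B j : ℕ) (u t : Γ) :
    f (testElement B j u t) = testElement B j (f u) (f t) := by
  simp [testElement]

end TestElement

namespace IsFreeProductZZTwo

variable {Γ : Type*} [Group Γ] {a s : Γ} (hΓ : IsFreeProductZZTwo a s)
include hΓ

theorem isQuasimorphism_oddPatternFun {c : ℕ → ℝ} {C : ℝ} (hc : ∀ j, |c j| ≤ C) (B p : ℕ) :
    IsQuasimorphism (hΓ.countingFun (oddPatternFun B p c) B) :=
  hΓ.isQuasimorphism_countingFun (abs_oddPatternFun_le hc) (oddPatternFun_neg B p c) B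

theorem hasRate_testElement {B p : ℕ} (hp : 0 < p) (hpB : p ≤ B) {c : ℕ → ℝ} {C : ℝ}
    (hc : ∀ j, |c j| ≤ C) (g : Γ) {e r z : ℤ} {l : List ℤ} (he : e ≠ 0) (heB : |e| ≤ B)
    (hrz : |z + r| ≤ B) (hl : ∀ x ∈ l, x ≠ 0 ∧ |x| ≤ B) (j : ℕ) :
    HasRate (hΓ.countingFun (oddPatternFun B p c) B)
      (testElement B j (g * a ^ e * g⁻¹) (g * evalWord a s (r :: (l ++ [z])) * g⁻¹))
      (patternFun B p c (z + r + e * scale B (3 * j)) (z + r + e * scale B (3 * j + 1))) := by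
  rw [← oddPatternFun_cyclic_sum he heB hrz hp hpB]
  -- Conjugation by `g` and the leading power of `a` makes the test element cyclically reduced. The
  -- leading power joins the last exponent, so the scales appear in the order `3 * j + 1, 3 * j + 2,
  -- 3 * j`.
  have h := (hΓ.isQuasimorphism_oddPatternFun hc B p).hasRate_conj
    (hΓ.hasRate_evalList_triple (f := oddPatternFun B p c) (B := B) (by positivity) hl
      (lt_abs_add_mul_scale (m := 3 * j + 1) he hrz) (lt_abs_add_mul_scale (m := 3 * j + 2) he hrz)
      (lt_abs_add_mul_scale (m := 3 * j) he hrz)) (g * a ^ (e * scale B (3 * j) + r))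
  convert h using 1
  simp only [testElement, conj_pow, hΓ.evalWord_cons, evalList_append, evalList, zpow_add, zpow_mul,
    zpow_natCast, mul_one, mul_inv_rev]
  group

theorem hasRate_testElement_base {B p : ℕ} (hp : 0 < p) (hpB : p ≤ B) {c : ℕ → ℝ} {C : ℝ}
    (hc : ∀ j, |c j| ≤ C) (j : ℕ) :
    HasRate (hΓ.countingFun (oddPatternFun B p c) B) (testElement B j (a ^ p) ((s * a) ^ p)) (c j) := by
  -- The word `(s * a) ^ p` has first exponent `0` and then `p` exponents `1`. So the big exponents
  -- are `p * scale B m + 1`, the values built into `patternFun`.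
  have h := hΓ.hasRate_testElement hp hpB hc 1 (e := p) (r := 0) (z := 1)
    (l := listPow [1] (p - 1)) (by omega) (by simpa using hpB) (by simp; omega)
    (fun x hx => by
      have := mem_of_mem_listPow hx
      rw [List.mem_singleton] at this
      subst this
      simp
      omega) j
  rw [hΓ.evalWord_zero_cons, evalList_append, evalList_listPow] at h
  have h1 : evalList a s [1] = s * a := by simp [evalList]
  rw [h1, ← pow_succ, Nat.sub_add_cancel hp] at h
  have h2 := patternFun_apply hp hpB c j
  rw [add_comm, add_comm (_ * _)] at h2
  simpa [h2] using h

/-- For any two elements, all but finitely many thresholds give nonnegative rates. -/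
theorem exists_threshold (u t : Γ) : ∃ B₀ : ℕ, ∀ B ≥ B₀, ∀ p, 0 < p → p ≤ B → ∀ j, ∃ A : ℝ, 0 ≤ A ∧
    ∀ (c : ℕ → ℝ) (C : ℝ), (∀ j, |c j| ≤ C) →
      HasRate (hΓ.countingFun (oddPatternFun B p c) B) (testElement B j u t) (A * c j) := by
  -- If the powers of `u` have exponents at most `M`, those of the test element are bounded
  -- independently of the scales, and a large threshold sees none of them.
  have hbdd : ∀ M : ℤ, 0 ≤ M → (∀ k : ℕ, hΓ.ExponentsLE M (u ^ k)) → ∃ B₀ : ℕ, ∀ B ≥ B₀, ∀ p, 0 < p →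
      p ≤ B → ∀ j, ∃ A : ℝ, 0 ≤ A ∧ ∀ (c : ℕ → ℝ) (C : ℝ), (∀ j, |c j| ≤ C) →
      HasRate (hΓ.countingFun (oddPatternFun B p c) B) (testElement B j u t) (A * c j) := by
    intro M hM hu
    obtain ⟨M', hM', ht⟩ := hΓ.exists_exponentsLE t
    refine ⟨(2 * (M + M' + M + M' + M + M')).toNat, fun B hB p _ _ j => ⟨0, le_rfl, fun c C hc => ?_⟩⟩
    rw [zero_mul]
    refine hΓ.hasRate_zero_of_exponentsLE (hΓ.isQuasimorphism_oddPatternFun hc B p)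
      (M := M + M' + M + M' + M + M') (by positivity) (by omega) ?_
    exact hΓ.exponentsLE_mul (hΓ.exponentsLE_mul (hΓ.exponentsLE_mul (hΓ.exponentsLE_mul
      (hΓ.exponentsLE_mul (hu _) ht) (hu _)) ht) (hu _)) ht
  obtain ⟨M, hM, hu⟩ := hΓ.exists_exponentsLE u
  obtain ⟨g, y, rfl, hy⟩ := hΓ.exists_conj hM hu
  obtain ⟨M₁, hM₁, hg⟩ := hΓ.exists_exponentsLE g
  obtain ⟨M₂, hM₂, hg'⟩ := hΓ.exists_exponentsLE g⁻¹
  have hbdd' : (∀ k : ℕ, hΓ.ExponentsLE (2 * M) (y ^ k)) → _ := fun h =>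
    hbdd (M₁ + 2 * M + M₂) (by positivity) fun k => by
      rw [conj_pow]
      exact hΓ.exponentsLE_mul (hΓ.exponentsLE_mul hg (h k)) hg'
  rcases hy with ⟨e, rfl⟩ | hy
  · rcases eq_or_ne e 0 with rfl | he
    · refine hbdd' fun k => ?_
      rw [zpow_zero, one_pow]
      exact hΓ.exponentsLE_one (by positivity)
    obtain ⟨τ, rfl⟩ : ∃ τ, t = g * τ * g⁻¹ := ⟨g⁻¹ * t * g, by group⟩
    obtain ⟨M', hM', hτ⟩ := hΓ.exists_exponentsLE τ
    have hred := hΓ.isReducedList_normalForm τ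
    have heval := hΓ.evalWord_normalForm τ
    unfold ExponentsLE at hτ
    obtain ⟨r, l, hrl⟩ := List.exists_cons_of_ne_nil hred.1
    rw [hrl] at hτ hred heval
    subst heval
    rcases List.eq_nil_or_concat l with rfl | ⟨l, z, rfl⟩
    -- Here `u` and `t` lie in the same conjugate of the group generated by `a`, and so does the
    -- test element.
    · refine ⟨0, fun B _ p _ _ j => ⟨0, le_rfl, fun c C hc => ?_⟩⟩
      rw [zero_mul]
      have h := (hΓ.isQuasimorphism_oddPatternFun hc B p).hasRate_conj
        (hΓ.hasRate_zpow (oddPatternFun B p c) B (e * scale B (3 * j) + r + e * scale B (3 * j + 1) + r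
          + e * scale B (3 * j + 2) + r)) g
      convert h using 1
      simp only [testElement, conj_pow, hΓ.evalWord_singleton, zpow_add, zpow_mul, zpow_natCast]
      group
    · rw [List.concat_eq_append] at *
      refine ⟨(|e| + 2 * M').toNat, fun B hB p hp hpB j => ?_⟩
      have heB : |e| ≤ B := by have := abs_nonneg e; omega
      have hMB : 2 * M' ≤ B := by have := abs_nonneg e; omega
      have hrz : |z + r| ≤ B := by
        have := abs_add_le z r
        have := hτ z (by simp)
        have := hτ r (by simp)
        linarith
      obtain ⟨A, hA, hAc⟩ := exists_patternFun_eq he heB hrz hp hpB j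
        (z + r + e * scale B (3 * j + 1))
      refine ⟨A, hA, fun c C hc => ?_⟩
      rw [← hAc]
      refine hΓ.hasRate_testElement hp hpB hc g he heB hrz (fun x hx => ⟨?_, ?_⟩) j
      · obtain ⟨p, q, rfl⟩ := List.append_of_mem hx
        exact hred.2 (r :: p) x (q ++ [z]) (by simp) (by simp) (by simp)
      · linarith [hτ x (by simp [hx])]
  · exact hbdd' hy

end IsFreeProductZZTwo

theorem IsFreeProductZZTwo.surjective {Γ K : Type*} [Group Γ] [Group K] {a s : Γ}
    (hΓ : IsFreeProductZZTwo a s) (f : K →* Γ) (ha : a ∈ f.range) (hs : s ∈ f.range) :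
    Function.Surjective f := by
  intro g
  obtain ⟨l, -, rfl⟩ := hΓ.exists_evalWord g
  refine f.range.mul_mem hs ?_
  induction l with
  | nil => exact f.range.one_mem
  | cons e l ih => exact f.range.mul_mem (f.range.mul_mem hs (f.range.zpow_mem ha e)) ih

/-! ### Realization of `ℤ ∗ ℤ/2` by permutations of normal forms -/

section Construction

/-- Adding `k` to the first entry. -/
def addHead (k : ℤ) : List ℤ → List ℤ
  | [] => []
  | x :: l => (x + k) :: l

theorem IsReducedList.replace_head {x : ℤ} {l : List ℤ} (h : IsReducedList (x :: l)) (y : ℤ) :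
    IsReducedList (y :: l) := by
  refine ⟨by simp, fun p z q e hp hq => ?_⟩
  obtain ⟨w, p, rfl⟩ := List.exists_cons_of_ne_nil hp
  rw [List.cons_append, List.cons.injEq] at e
  exact h.2 (x :: p) z q (by simp [e.2]) (by simp) hq

theorem IsReducedList.addHead {l : List ℤ} (h : IsReducedList l) (k : ℤ) :
    IsReducedList (addHead k l) := by
  cases l with
  | nil => exact h
  | cons x l => exact h.replace_head _

theorem addHead_addHead (k m : ℤ) (l : List ℤ) : addHead k (addHead m l) = addHead (m + k) l := by
  cases l <;> simp [addHead, add_assoc]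

theorem addHead_zero (l : List ℤ) : addHead 0 l = l := by
  cases l <;> simp [addHead]

/-- The effect on normal forms of the multiplication by the involution on the left. -/
def toggle : List ℤ → List ℤ
  | [] => []
  | [x] => [0, x]
  | x :: y :: l => if x = 0 then y :: l else 0 :: x :: y :: l

theorem toggle_cons_of_ne {x : ℤ} {l : List ℤ} (h : l ≠ [] → x ≠ 0) :
    toggle (x :: l) = 0 :: x :: l := by
  cases l with
  | nil => rfl
  | cons y l => simp [toggle, h]

theorem IsReducedList.ne_zero {x y : ℤ} {l : List ℤ} (h : IsReducedList (x :: y :: l))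
    (hl : l ≠ []) : y ≠ 0 :=
  h.2 [x] y l (by simp) (by simp) hl

theorem IsReducedList.cons_cons {x y : ℤ} {l : List ℤ} (h : IsReducedList (y :: l))
    (hy : l ≠ [] → y ≠ 0) : IsReducedList (x :: y :: l) := by
  refine ⟨by simp, fun p z q e hp hq => ?_⟩
  obtain ⟨w, p, rfl⟩ := List.exists_cons_of_ne_nil hp
  rw [List.cons_append, List.cons.injEq] at e
  cases p with
  | nil =>
    simp only [List.nil_append, List.cons.injEq] at e
    rw [← e.2.1]
    exact hy (by rw [e.2.2]; exact hq)
  | cons v p => exact h.2 (v :: p) z q e.2 (by simp) hq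

theorem IsReducedList.toggle {l : List ℤ} (h : IsReducedList l) : IsReducedList (toggle l) := by
  match l, h with
  | [], h => exact h
  | [x], h => exact h.cons_cons (by simp)
  | x :: y :: l, h =>
    by_cases hx : x = 0
    · simpa [_root_.toggle, hx] using h.of_cons (by simp)
    · simpa [_root_.toggle, hx] using h.cons_cons fun _ => hx

theorem IsReducedList.toggle_toggle {l : List ℤ} (h : IsReducedList l) :
    _root_.toggle (_root_.toggle l) = l := by
  match l, h with
  | [], h => rfl
  | [x], h => simp [_root_.toggle]
  | x :: y :: l, h =>
    by_cases hx : x = 0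
    · subst hx
      rw [show _root_.toggle (0 :: y :: l) = y :: l by simp [_root_.toggle]]
      exact toggle_cons_of_ne h.ne_zero
    · simp [_root_.toggle, hx]

/-- The translation of the first exponent, as a permutation of the normal forms. -/
def translationPerm : Equiv.Perm {l : List ℤ // IsReducedList l} where
  toFun l := ⟨addHead 1 l.1, l.2.addHead 1⟩
  invFun l := ⟨addHead (-1) l.1, l.2.addHead (-1)⟩
  left_inv l := by simp [addHead_addHead, addHead_zero]
  right_inv l := by simp [addHead_addHead, addHead_zero]

/-- The involution on normal forms. -/
def togglePerm : Equiv.Perm {l : List ℤ // IsReducedList l} where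
  toFun l := ⟨toggle l.1, l.2.toggle⟩
  invFun l := ⟨toggle l.1, l.2.toggle⟩
  left_inv l := Subtype.ext l.2.toggle_toggle
  right_inv l := Subtype.ext l.2.toggle_toggle

theorem togglePerm_mul_self : togglePerm * togglePerm = 1 :=
  Equiv.ext fun l => Subtype.ext l.2.toggle_toggle

theorem translationPerm_zpow_apply (k : ℤ) (l : {l : List ℤ // IsReducedList l}) :
    ((translationPerm ^ k) l).1 = addHead k l.1 := by
  induction k generalizing l with
  | zero => simp [addHead_zero]
  | succ k ih =>
    rw [zpow_add_one, Equiv.Perm.mul_apply, ih]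
    exact (addHead_addHead _ _ _).trans (by rw [add_comm])
  | pred k ih =>
    rw [zpow_sub_one, Equiv.Perm.mul_apply, ih]
    exact (addHead_addHead _ _ _).trans (by congr 1; ring)

/-- Van der Waerden's trick: a word applied to the normal form `[0]` of the identity returns the
word, so distinct normal forms give distinct permutations. -/
theorem evalWord_perm_apply {l : List ℤ} (hl : IsReducedList l) :
    (evalWord translationPerm togglePerm l ⟨[0], IsReducedList.singleton 0⟩).1 = l := by
  have hW : ∀ x l, evalWord translationPerm togglePerm (x :: l)
      = translationPerm ^ x * evalList translationPerm togglePerm l := fun x l => by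
    simp [evalWord, evalList, ← mul_assoc, togglePerm_mul_self]
  induction l with
  | nil => exact absurd rfl hl.1
  | cons x l ih =>
    rw [hW, Equiv.Perm.mul_apply, translationPerm_zpow_apply]
    cases l with
    | nil => simp [evalList, addHead]
    | cons y l =>
      have hs : evalList translationPerm togglePerm (y :: l)
          = togglePerm * evalWord translationPerm togglePerm (y :: l) := by
        rw [evalWord, ← mul_assoc, togglePerm_mul_self, one_mul]
      rw [hs, Equiv.Perm.mul_apply]
      change addHead x (toggle (evalWord translationPerm togglePerm (y :: l) _).1) = _
      rw [ih (hl.of_cons (by simp)), toggle_cons_of_ne hl.ne_zero]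
      simp [addHead]

theorem exists_isFreeProductZZTwo :
    ∃ (Γ : Type) (_ : Group Γ) (a s : Γ), IsFreeProductZZTwo a s := by
  let P := Subgroup.closure {translationPerm, togglePerm}
  let a : P := ⟨translationPerm, Subgroup.subset_closure (by simp)⟩
  let s : P := ⟨togglePerm, Subgroup.subset_closure (by simp)⟩
  have hs : s * s = 1 := Subtype.ext togglePerm_mul_self
  have hcoe : ∀ l, ((evalWord a s l : P) : Equiv.Perm _) = evalWord translationPerm togglePerm l := by
    intro l
    have : ∀ l, ((evalList a s l : P) : Equiv.Perm _) = evalList translationPerm togglePerm l := by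
      intro l
      induction l with
      | nil => rfl
      | cons x l ih => simp [evalList, ih, a, s]
    simp [evalWord, this, s]
  refine ⟨P, inferInstance, a, s, hs, ?_, ?_⟩
  · rintro ⟨g, hg⟩
    suffices H : ∃ l, IsReducedList l ∧ evalWord translationPerm togglePerm l = g by
      obtain ⟨l, hl, h⟩ := H
      exact ⟨l, hl, Subtype.ext ((hcoe l).trans h)⟩
    induction hg using Subgroup.closure_induction with
    | mem x hx =>
      rcases hx with rfl | rfl
      · exact ⟨[1], IsReducedList.singleton 1, by
          simp [evalWord, evalList, ← mul_assoc, togglePerm_mul_self]⟩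
      · exact ⟨[0, 0], (IsReducedList.singleton 0).cons_cons (by simp), by
          simp [evalWord, evalList, togglePerm_mul_self]⟩
    | one => exact ⟨[0], IsReducedList.singleton 0, by
        simp [evalWord, evalList, togglePerm_mul_self]⟩
    | mul x y _ _ hx hy =>
      obtain ⟨l, hl, rfl⟩ := hx
      obtain ⟨m, hm, rfl⟩ := hy
      obtain ⟨p, x, c, y, q, rfl, rfl, h⟩ := hl.exists_merge hm
      exact ⟨_, h, (evalWord_mul togglePerm_mul_self p c q x y).symm⟩
    | inv x _ hx =>
      obtain ⟨l, hl, rfl⟩ := hx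
      exact ⟨_, hl.revNeg, (evalWord_inv togglePerm_mul_self l).symm⟩
  · intro l m hl hm h
    have h := congrArg (Subtype.val : P → _) h
    rw [hcoe, hcoe] at h
    rw [← evalWord_perm_apply hl, h, evalWord_perm_apply hm]

theorem exists_freeGroup_surjective {n : ℕ} (hn : 2 ≤ n) : ∃ (Γ : Type) (_ : Group Γ) (a s : Γ)
    (_ : IsFreeProductZZTwo a s) (f : FreeGroup (Fin n) →* Γ), Function.Surjective f := by
  obtain ⟨Γ, _, a, s, hΓ⟩ := exists_isFreeProductZZTwo
  refine ⟨Γ, inferInstance, a, s, hΓ,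
    FreeGroup.lift (fun i : Fin n => if i = ⟨0, by omega⟩ then a else s), hΓ.surjective _ ?_ ?_⟩
  · exact ⟨FreeGroup.of ⟨0, by omega⟩, by simp⟩
  · exact ⟨FreeGroup.of ⟨1, by omega⟩, by simp⟩

end Construction

/-! ### Linearity in the coefficients -/

theorem pairSum_add (f f' : ℤ → ℤ → ℝ) (l : List ℤ) :
    pairSum (fun x y => f x y + f' x y) l = pairSum f l + pairSum f' l := by
  match l with
  | [] => simp [pairSum]
  | [x] => simp [pairSum]
  | x :: y :: l =>
    simp only [pairSum, pairSum_add f f' (y :: l)]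
    ring

theorem pairSum_smul (r : ℝ) (f : ℤ → ℤ → ℝ) (l : List ℤ) :
    pairSum (fun x y => r * f x y) l = r * pairSum f l := by
  match l with
  | [] => simp [pairSum]
  | [x] => simp [pairSum]
  | x :: y :: l =>
    simp only [pairSum, pairSum_smul r f (y :: l)]
    ring

/-- The quasimorphism attached to a sequence of coefficients, linearly in the sequence. -/
noncomputable def IsFreeProductZZTwo.countingMap {Γ : Type*} [Group Γ] {a s : Γ}
    (hΓ : IsFreeProductZZTwo a s) (B p : ℕ) : (ℕ → ℝ) →ₗ[ℝ] (Γ → ℝ) where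
  toFun c := hΓ.countingFun (oddPatternFun B p c) B
  map_add' c d := by
    funext g
    simp only [countingFun, bigPairSum, Pi.add_apply, ← pairSum_add, ← oddPatternFun_add]
  map_smul' r c := by
    funext g
    simp only [countingFun, bigPairSum, Pi.smul_apply, smul_eq_mul, ← pairSum_smul,
      ← oddPatternFun_smul, RingHom.id_apply]

/-! ### Transfer from a subgroup of finite index -/

section Transfer

variable {G : Type*} [Group G] (H : Subgroup G)

/-- The element of `H` by which `g` acts on the chosen representative of the coset `q`. -/
noncomputable def cosetCocycle (q : G ⧸ H) (g : G) : H :=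
  ⟨(g • q).out⁻¹ * (g * q.out), by
    rw [← QuotientGroup.eq]
    conv_rhs => rw [← smul_eq_mul, ← MulAction.Quotient.smul_coe]
    simp⟩

theorem cosetCocycle_mul (q : G ⧸ H) (g h : G) :
    cosetCocycle H q (g * h) = cosetCocycle H (h • q) g * cosetCocycle H q h := by
  apply Subtype.ext
  simp only [cosetCocycle, Subgroup.coe_mul, mul_smul]
  group

/-- Conjugation by the chosen representative of a coset, on the normal core of `H`. -/
noncomputable def cosetConj (q : G ⧸ H) : H.normalCore →* H where
  toFun x := ⟨q.out⁻¹ * x * q.out, by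
    have := H.normalCore_normal.conj_mem x x.2 q.out⁻¹
    rw [inv_inv] at this
    exact H.normalCore_le this⟩
  map_one' := by simp
  map_mul' x y := by
    apply Subtype.ext
    simp [mul_assoc]

theorem cosetCocycle_of_mem_normalCore (q : G ⧸ H) (x : H.normalCore) :
    cosetCocycle H q x = cosetConj H q x := by
  have hq : (x : G) • q = q := by
    conv_lhs => rw [← QuotientGroup.out_eq' q]
    conv_rhs => rw [← QuotientGroup.out_eq' q]
    rw [MulAction.Quotient.smul_coe, QuotientGroup.eq, smul_eq_mul]
    have := H.normalCore_normal.conj_mem (x : G)⁻¹ (H.normalCore.inv_mem x.2) q.out⁻¹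
    rw [inv_inv] at this
    simpa [mul_assoc] using H.normalCore_le this
  apply Subtype.ext
  simp [cosetCocycle, cosetConj, hq, mul_assoc]

variable [Fintype (G ⧸ H)]

/-- The transfer of a function from a subgroup of finite index. -/
noncomputable def transferFun : (H → ℝ) →ₗ[ℝ] (G → ℝ) where
  toFun φ g := ∑ q : G ⧸ H, φ (cosetCocycle H q g)
  map_add' φ ψ := by
    funext g
    simp [Finset.sum_add_distrib]
  map_smul' r φ := by
    funext g
    simp [Finset.mul_sum]

theorem IsQuasimorphism.transferFun {φ : H → ℝ} (hφ : IsQuasimorphism φ) :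
    IsQuasimorphism (transferFun H φ) := by
  obtain ⟨D, hD⟩ := hφ
  refine ⟨∑ _q : G ⧸ H, D, fun g h => ?_⟩
  -- Reindexing by the permutation `q ↦ h • q` matches the cocycle identity, so the defect is
  -- bounded coset by coset.
  have h1 : ∑ q : G ⧸ H, φ (cosetCocycle H q g) = ∑ q : G ⧸ H, φ (cosetCocycle H (h • q) g) :=
    (Equiv.sum_comp (MulAction.toPerm h) fun q => φ (cosetCocycle H q g)).symm
  change |∑ q : G ⧸ H, φ (cosetCocycle H q (g * h)) - ∑ q : G ⧸ H, φ (cosetCocycle H q g)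
    - ∑ q : G ⧸ H, φ (cosetCocycle H q h)| ≤ _
  rw [h1, ← Finset.sum_sub_distrib, ← Finset.sum_sub_distrib]
  refine (Finset.abs_sum_le_sum_abs _ _).trans (Finset.sum_le_sum fun q _ => ?_)
  rw [cosetCocycle_mul]
  exact hD _ _

theorem HasRate.transferFun {φ : H → ℝ} {x : H.normalCore} {r : G ⧸ H → ℝ}
    (h : ∀ q, HasRate φ (cosetConj H q x) (r q)) :
    HasRate (transferFun H φ) (x : G) (∑ q, r q) := by
  obtain ⟨C, hC⟩ := HasRate.sum (g := x) (φ := fun q y => φ (cosetConj H q y)) (r := r) Finset.univ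
    fun q _ => by
      obtain ⟨C, hC⟩ := h q
      exact ⟨C, fun k => by simpa using hC k⟩
  refine ⟨C, fun k => ?_⟩
  have := hC k
  simp only [← cosetCocycle_of_mem_normalCore] at this
  exact this

end Transfer

theorem IsQuasimorphism.comp {Γ K : Type*} [Group Γ] [Group K] {φ : Γ → ℝ} (hφ : IsQuasimorphism φ)
    (f : K →* Γ) : IsQuasimorphism (φ ∘ f) := by
  obtain ⟨D, hD⟩ := hφ
  exact ⟨D, fun g h => by simpa using hD (f g) (f h)⟩

/-! ### Quasimorphisms parametrized by bounded sequences -/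

/-- The bounded sequences of real numbers. -/
def boundedSeq : Submodule ℝ (ℕ → ℝ) where
  carrier := {c | ∃ C : ℝ, ∀ j, |c j| ≤ C}
  add_mem' := by
    rintro f g ⟨C, hC⟩ ⟨D, hD⟩
    exact ⟨C + D, fun x => (abs_add_le _ _).trans (add_le_add (hC x) (hD x))⟩
  zero_mem' := ⟨0, fun x => by simp⟩
  smul_mem' := by
    rintro r f ⟨C, hC⟩
    refine ⟨|r| * C, fun x => ?_⟩
    rw [Pi.smul_apply, smul_eq_mul, abs_mul]
    exact mul_le_mul_of_nonneg_left (hC x) (abs_nonneg r)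

/-- A group with a subgroup of finite index that maps onto `ℤ ∗ ℤ/2` has a family of
quasimorphisms, linearly parametrized by the bounded sequences, whose coefficients are recovered from
the rates at suitable elements. -/
theorem exists_quasimorphisms {G : Type*} [Group G] (H : Subgroup G) [H.FiniteIndex]
    {Γ : Type*} [Group Γ] {a s : Γ} (hΓ : IsFreeProductZZTwo a s) (ρ : H →* Γ)
    (hρ : Function.Surjective ρ) :
    ∃ (Φ : (ℕ → ℝ) →ₗ[ℝ] (G → ℝ)) (x : ℕ → G) (A : ℕ → ℝ), (∀ j, 0 < A j) ∧
      ∀ c ∈ boundedSeq, IsQuasimorphism (Φ c) ∧ ∀ j, HasRate (Φ c) (x j) (A j * c j) := by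
  classical
  have : Fintype (G ⧸ H) := Fintype.ofFinite _
  -- Every `p`-th power in `G` lies in the normal core, so `p`-th powers in `Γ` lift to it.
  let p := H.normalCore.index
  have hp : 0 < p := Nat.pos_of_ne_zero Subgroup.FiniteIndex.index_ne_zero
  let q₀ : G ⧸ H := ((1 : G) : G ⧸ H)
  have lift : ∀ g : Γ, ∃ u : H.normalCore, ρ (cosetConj H q₀ u) = g ^ p := by
    intro g
    obtain ⟨h, rfl⟩ := hρ g
    have hh : (h : G) ^ p ∈ H.normalCore := Subgroup.pow_index_mem _ _
    -- The chosen representative of the trivial coset need not be `1`, so its conjugation is undone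
    -- in advance.
    refine ⟨⟨q₀.out * (h : G) ^ p * q₀.out⁻¹, H.normalCore_normal.conj_mem _ hh _⟩, ?_⟩
    rw [← map_pow]
    congr 1
    apply Subtype.ext
    simp [cosetConj, mul_assoc]
  obtain ⟨u, hu⟩ := lift a
  obtain ⟨t, ht⟩ := lift (s * a)
  choose B₀ hB₀ using fun q : G ⧸ H =>
    hΓ.exists_threshold (ρ (cosetConj H q u)) (ρ (cosetConj H q t))
  -- With `u` and `t` fixed, one threshold serves all of the finitely many cosets.
  let B := p + ∑ q, B₀ q
  have hB : ∀ q, B ≥ B₀ q := fun q =>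
    (Finset.single_le_sum (f := B₀) (fun _ _ => Nat.zero_le _) (Finset.mem_univ q)).trans
      (Nat.le_add_left _ _)
  have hpB : p ≤ B := Nat.le_add_right _ _
  choose A hA hAc using fun q => hB₀ q B (hB q) p hp hpB
  have hcomp : ∀ c q j r, HasRate (hΓ.countingMap B p c)
      (testElement B j (ρ (cosetConj H q u)) (ρ (cosetConj H q t))) r →
      HasRate (hΓ.countingMap B p c ∘ ρ) (cosetConj H q (testElement B j u t)) r := by
    rintro c q j r ⟨C, hC⟩
    refine ⟨C, fun k => ?_⟩
    simpa [map_testElement] using hC k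
  refine ⟨transferFun H ∘ₗ LinearMap.funLeft ℝ ℝ ρ ∘ₗ hΓ.countingMap B p,
    fun j => (testElement B j u t : H.normalCore), fun j => ∑ q, if q = q₀ then 1 else A q j,
    fun j => ?_, fun c ⟨C, hc⟩ => ⟨?_, fun j => ?_⟩⟩
  · refine Finset.sum_pos' (fun q _ => ?_) ⟨q₀, Finset.mem_univ _, by simp⟩
    split_ifs
    exacts [zero_le_one, hA q j]
  · exact ((hΓ.isQuasimorphism_oddPatternFun hc B p).comp ρ).transferFun H
  · rw [Finset.sum_mul]
    refine HasRate.transferFun H (φ := hΓ.countingMap B p c ∘ ρ) fun q => hcomp c q j _ ?_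
    split_ifs with hq
    · subst hq
      rw [hu, ht, one_mul]
      exact hΓ.hasRate_testElement_base hp hpB hc j
    · exact hAc q j c C hc

/-- The geometric sequences with ratios in `(0, 1)` are eigenvectors of the shift with distinct
eigenvalues. -/
theorem continuum_le_rank_boundedSeq : Cardinal.continuum ≤ Module.rank ℝ boundedSeq := by
  let S : Module.End ℝ boundedSeq :=
    { toFun := fun c => ⟨fun j => c.1 (j + 1), by
        obtain ⟨C, hC⟩ := c.2
        exact ⟨C, fun j => hC _⟩⟩
      map_add' := fun c d => rfl
      map_smul' := fun r c => rfl }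
  let v : Set.Ioo (0 : ℝ) 1 → boundedSeq := fun r => ⟨fun j => r.1 ^ j, 1, fun j => by
    rw [abs_pow, abs_of_pos r.2.1]
    exact pow_le_one₀ r.2.1.le r.2.2.le⟩
  have hv : LinearIndependent ℝ v := by
    refine Module.End.eigenvectors_linearIndependent' S (fun r : Set.Ioo (0 : ℝ) 1 => r.1)
      Subtype.val_injective v fun r => ?_
    rw [Module.End.hasEigenvector_iff, Module.End.mem_eigenspace_iff]
    refine ⟨Subtype.ext (funext fun j => pow_succ' r.1 j), fun h => ?_⟩
    have := congrFun (congrArg Subtype.val h) 0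
    simp [v] at this
  rw [← Cardinal.mk_Ioo_real (zero_lt_one' ℝ)]
  exact hv.cardinal_le_rank

/-! ### The dimension of bounded cohomology -/

namespace BoundedCohomology

variable {G : Type*} [Group G]

theorem coboundary_one_apply (φ : G → ℝ) (x : Fin 2 → G) :
    coboundary G 1 (fun y => φ (y 0)) x = φ (x 1) - φ (x 0 * x 1) + φ (x 0) := by
  simp [coboundary, Fin.sum_univ_two, Fin.contractNth, sub_eq_add_neg, add_assoc]

theorem coboundary_mem_boundedCocycles {φ : G → ℝ} (hφ : IsQuasimorphism φ) :
    coboundary G 1 (fun y => φ (y 0)) ∈ boundedCocycles G 2 := by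
  refine ⟨?_, coboundary_coboundary G 1 _⟩
  obtain ⟨D, hD⟩ := hφ
  refine ⟨D, fun x => ?_⟩
  rw [coboundary_one_apply, ← abs_neg]
  convert hD (x 0) (x 1) using 2
  ring

/-- Subtracting the bounded primitive from `φ` leaves a homomorphism at bounded distance from `φ`.
-/
theorem exists_hom_of_mem_boundedCoboundaries {φ : G → ℝ}
    (hφ : coboundary G 1 (fun y => φ (y 0)) ∈ boundedCoboundaries G 2) :
    ∃ h : G → ℝ, (∀ g g', h (g * g') = h g + h g') ∧ ∀ g, HasRate φ g (h g) := by
  obtain ⟨β, ⟨C, hC⟩, hβ⟩ := hφ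
  let β' : G → ℝ := fun g => β fun _ => g
  have hβ' : β = fun y => β' (y 0) := by
    funext y
    simp only [β']
    congr 1
    funext i
    rw [Subsingleton.elim i 0]
  have hadd : ∀ g g', (φ - β') (g * g') = (φ - β') g + (φ - β') g' := by
    intro g g'
    have := congrFun hβ ![g, g']
    rw [hβ', coboundary_one_apply, coboundary_one_apply] at this
    simp only [Matrix.cons_val_zero, Matrix.cons_val_one] at this
    simp only [Pi.sub_apply]
    linarith
  refine ⟨φ - β', hadd, fun g => ⟨C, fun k => ?_⟩⟩
  have hpow : (φ - β') (g ^ k) = k * (φ - β') g := by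
    induction k with
    | zero =>
      have := hadd 1 1
      rw [one_mul] at this
      simp only [pow_zero, Nat.cast_zero, zero_mul]
      linarith
    | succ k ih =>
      rw [pow_succ, hadd, ih]
      push_cast
      ring
  rw [← hpow]
  simpa [β'] using hC fun _ => g ^ k

theorem rank_H_le [Countable G] (n : ℕ) : Module.rank ℝ (H G n) ≤ Cardinal.continuum := by
  refine (rank_quotient_le _).trans ((rank_le_card ℝ _).trans ((Cardinal.mk_set_le _).trans ?_))
  rw [Cardinal.mk_arrow, Cardinal.mk_real, Cardinal.lift_continuum]
  refine (Cardinal.power_le_power_left Cardinal.continuum_ne_zero ?_).trans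
    Cardinal.continuum_power_aleph0.le
  rw [Cardinal.lift_le_aleph0]
  exact Cardinal.mk_le_aleph0

/-- Classes of quasimorphisms are trivial in bounded cohomology only if the quasimorphism is close to
a homomorphism. -/
theorem continuum_le_rank_H_two {ι : Type*} [Finite ι] {S : ι → G}
    (hS : Subgroup.closure (Set.range S) = ⊤) (Φ : (ℕ → ℝ) →ₗ[ℝ] (G → ℝ)) (x : ℕ → G) {A : ℕ → ℝ}
    (hA : ∀ j, 0 < A j)
    (hΦ : ∀ c ∈ boundedSeq, IsQuasimorphism (Φ c) ∧ ∀ j, HasRate (Φ c) (x j) (A j * c j)) :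
    Cardinal.continuum ≤ Module.rank ℝ (H G 2) := by
  let δ : boundedSeq →ₗ[ℝ] boundedCocycles G 2 :=
    (coboundary G 1 ∘ₗ LinearMap.funLeft ℝ ℝ (fun y : Fin 1 → G => y 0) ∘ₗ Φ ∘ₗ
      boundedSeq.subtype).codRestrict _ fun c => coboundary_mem_boundedCocycles (hΦ c c.2).1
  let T : boundedSeq →ₗ[ℝ] H G 2 := Submodule.mkQ _ ∘ₗ δ
  have hker : ∀ c : LinearMap.ker T, ∃ h : G → ℝ, (∀ g g', h (g * g') = h g + h g') ∧
      ∀ g, HasRate (Φ c) g (h g) := by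
    rintro ⟨c, hc⟩
    refine exists_hom_of_mem_boundedCoboundaries ?_
    exact (Submodule.Quotient.mk_eq_zero _ (x := δ c)).1 hc
  choose h hadd hrate using hker
  -- The homomorphism `h c` is unique, being given by rates, so it is linear in `c` despite the
  -- choice. Its values on the finite generating family embed the kernel in a finite-dimensional
  -- space.
  let R : LinearMap.ker T →ₗ[ℝ] (ι → ℝ) :=
    { toFun := fun c i => h c (S i)
      map_add' := fun c d => by
        funext i
        refine (hrate (c + d) (S i)).unique ?_
        have := (hrate c (S i)).add (hrate d (S i))
        rw [← map_add] at this
        exact this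
      map_smul' := fun r c => by
        funext i
        refine (hrate (r • c) (S i)).unique ?_
        have := (hrate c (S i)).smul r
        rw [← map_smul] at this
        exact this }
  have hR : Function.Injective R := by
    intro c d hcd
    have h1 : ∀ c, h c 1 = 0 := by
      intro c
      have := hadd c 1 1
      rw [one_mul] at this
      linarith
    have heq : ∀ g, h c g = h d g := by
      intro g
      have hg : g ∈ Subgroup.closure (Set.range S) := hS ▸ Subgroup.mem_top g
      induction hg using Subgroup.closure_induction with
      | mem y hy =>
        obtain ⟨i, rfl⟩ := hy
        exact congrFun hcd i
      | one => rw [h1, h1]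
      | mul y z _ _ hy hz => rw [hadd, hadd, hy, hz]
      | inv y _ hy =>
        have hc := hadd c y y⁻¹
        have hd := hadd d y y⁻¹
        rw [mul_inv_cancel, h1] at hc hd
        linarith
    -- The value of `h c` at `x j` is the rate `A j * c j`, so the homomorphism determines the
    -- sequence.
    refine Subtype.ext (Subtype.ext (funext fun j => ?_))
    have hc := ((hΦ c c.1.2).2 j).unique (hrate c (x j))
    have hd := ((hΦ d d.1.2).2 j).unique (hrate d (x j))
    exact mul_left_cancel₀ (hA j).ne' (by rw [hc, hd, heq])
  have hfin : Module.Finite ℝ (LinearMap.ker T) := Module.Finite.of_injective R hR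
  have hquot : Cardinal.continuum ≤ Module.rank ℝ (boundedSeq ⧸ LinearMap.ker T) := by
    by_contra! hlt
    refine continuum_le_rank_boundedSeq.not_gt ?_
    rw [← Submodule.rank_quotient_add_rank (LinearMap.ker T)]
    exact Cardinal.add_lt_of_lt Cardinal.aleph0_le_continuum hlt
      ((Module.rank_lt_aleph0 ℝ _).trans Cardinal.aleph0_lt_continuum)
  have hle := LinearMap.lift_rank_le_of_injective ((LinearMap.ker T).liftQ T le_rfl)
    (LinearMap.ker_eq_bot.1 (Submodule.ker_liftQ_eq_bot _ _ _ le_rfl))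
  simpa using (Cardinal.lift_le.2 hquot).trans hle

end BoundedCohomology

theorem theorem4p4 {G : Type*} [Group G] [Group.IsFinitelyPresented G]
    (H : Subgroup G) [H.FiniteIndex] (n : ℕ) (hn : 2 ≤ n)
    (σ : H →* FreeGroup (Fin n)) (hσ : Function.Surjective σ) :
    Module.rank ℝ (BoundedCohomology.H G 2) = Cardinal.continuum := by
  obtain ⟨m, φ, hφ, -⟩ := Group.IsFinitelyPresented.out (G := G)
  have : Countable G := hφ.countable
  refine le_antisymm (BoundedCohomology.rank_H_le 2) ?_
  obtain ⟨Γ, _, a, s, hΓ, f, hf⟩ := exists_freeGroup_surjective hn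
  obtain ⟨Φ, x, A, hA, hΦ⟩ := exists_quasimorphisms H hΓ (f.comp σ) (hf.comp hσ)
  refine BoundedCohomology.continuum_le_rank_H_two (S := fun i => φ (FreeGroup.of i)) ?_ Φ x hA hΦ
  rw [Set.range_comp' φ, ← MonoidHom.map_closure, FreeGroup.closure_range_of,
    Subgroup.map_top_of_surjective φ hφ]
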